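/- All graphs are finite, simple and undirected. A graph $G=(V,E)$ is a *sum graph* if there is an injective map $\lambda:V\to\{1,2,3,\dots\}$ such that two distinct vertices $x,y$ are adjacent if and only if $\lambda(x)+\lambda(y)=\lambda(z)$ for some $z\in V$. The *sum number* $\sigma(G)$ of a graph $G$ without isolated vertices is the minimum number $k$ such that the disjoint union $G+N_k$ of $G$ with $k$ isolated vertices is a sum graph. Let $\delta(G)$ denote the minimum degree of $G$, let $C_n$ and $P_n$ denote the cycle and the path on $n$ vertices, and let $+$ denote the disjoint union of graphs. Theorem. Let $G$ be a graph without isolated vertices in which every vertex has degree at most two. If $G$ is isomorphic to $C_4$ or to $C_4+P_2$, then $\sigma(G)=\delta(G)+1$. Otherwise, $\sigma(G)=\delta(G)$. -/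

import Mathlib

universe u

/-- A sum labelling of a graph: an injective labelling of the vertices by positive integers such
that two distinct vertices are adjacent if and only if the sum of their labels is the label of
some vertex. -/
def SimpleGraph.IsSumLabelling {V : Type u} (G : SimpleGraph V) (l : V → ℕ) : Prop :=
  Function.Injective l ∧ (∀ v, 0 < l v) ∧
    ∀ x y, G.Adj x y ↔ x ≠ y ∧ ∃ z, l z = l x + l y

/-- A graph is a sum graph if it admits a sum labelling. -/
def SimpleGraph.IsSumGraph {V : Type u} (G : SimpleGraph V) : Prop :=
  ∃ l : V → ℕ, G.IsSumLabelling l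

/-- The disjoint union of `G` with `k` isolated vertices. -/
def SimpleGraph.addIsolates {V : Type u} (G : SimpleGraph V) (k : ℕ) : SimpleGraph (V ⊕ Fin k) :=
  G ⊕g (⊥ : SimpleGraph (Fin k))

/-- Every finite graph becomes a sum graph after adding some number of isolated vertices, so the
minimum defining the sum number is taken over a nonempty set. -/
theorem SimpleGraph.exists_isSumGraph_addIsolates {V : Type u} [Finite V] (G : SimpleGraph V) :
    ∃ k : ℕ, (G.addIsolates k).IsSumGraph := by
  classical
  obtain ⟨n, ⟨e⟩⟩ := Finite.exists_equiv_fin V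
  let f : V → ℕ := fun v => 5 * 2 ^ (e v : ℕ) + 1
  have hf : Function.Injective f := by
    intro a b h
    have h1 : 2 ^ (e a : ℕ) = 2 ^ (e b : ℕ) := by simp only [f] at h; omega
    exact e.injective (Fin.ext (Nat.pow_right_injective le_rfl h1))
  have hmod : ∀ v, f v % 5 = 1 := by intro v; simp only [f]; omega
  have hsidon : ∀ a b c d : V, a ≠ b → f a + f b = f c + f d →
      (a = c ∧ b = d) ∨ (a = d ∧ b = c) := by
    intro a b c d hab h
    have key : ∀ i j k l : ℕ, i < j → k ≤ l → 2 ^ i + 2 ^ j = 2 ^ k + 2 ^ l → i = k ∧ j = l := by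
      intro i j k l hij hkl h
      have hi : 0 < 2 ^ i := by positivity
      have hk : 0 < 2 ^ k := by positivity
      have hij' : 2 ^ i < 2 ^ j := Nat.pow_lt_pow_right (by norm_num) hij
      have hkl' : 2 ^ k ≤ 2 ^ l := Nat.pow_le_pow_right (by norm_num) hkl
      rcases lt_trichotomy j l with hjl | rfl | hjl
      · have : 2 ^ (j + 1) ≤ 2 ^ l := Nat.pow_le_pow_right (by norm_num) hjl
        rw [pow_succ] at this
        omega
      · exact ⟨Nat.pow_right_injective le_rfl (by simpa using h), rfl⟩
      · have : 2 ^ (l + 1) ≤ 2 ^ j := Nat.pow_le_pow_right (by norm_num) hjl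
        rw [pow_succ] at this
        omega
    have h1 : 2 ^ (e a : ℕ) + 2 ^ (e b : ℕ) = 2 ^ (e c : ℕ) + 2 ^ (e d : ℕ) := by
      simp only [f] at h; omega
    have hab' : (e a : ℕ) ≠ e b := fun h => hab (e.injective (Fin.ext h))
    have fin : ∀ x y : V, (e x : ℕ) = e y → x = y := fun x y h => e.injective (Fin.ext h)
    rcases lt_or_gt_of_ne hab' with h2 | h2 <;> rcases le_total (e c : ℕ) (e d) with h3 | h3
    · obtain ⟨p, q⟩ := key _ _ _ _ h2 h3 h1
      exact Or.inl ⟨fin _ _ p, fin _ _ q⟩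
    · obtain ⟨p, q⟩ := key _ _ _ _ h2 h3 (by omega)
      exact Or.inr ⟨fin _ _ p, fin _ _ q⟩
    · obtain ⟨p, q⟩ := key _ _ _ _ h2 h3 (by omega)
      exact Or.inr ⟨fin _ _ q, fin _ _ p⟩
    · obtain ⟨p, q⟩ := key _ _ _ _ h2 h3 (by omega)
      exact Or.inl ⟨fin _ _ q, fin _ _ p⟩
  let S : Set ℕ := {m | ∃ a b : V, G.Adj a b ∧ m = f a + f b}
  have hS : S.Finite := by
    refine (Set.finite_range (fun p : V × V => f p.1 + f p.2)).subset ?_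
    rintro m ⟨a, b, -, rfl⟩
    exact ⟨(a, b), rfl⟩
  have hSmod : ∀ m ∈ S, m % 5 = 2 := by
    rintro m ⟨a, b, -, rfl⟩
    have := hmod a
    have := hmod b
    omega
  have : Finite S := hS
  obtain ⟨k, ⟨g⟩⟩ := Finite.exists_equiv_fin S
  have hg : ∀ i, (g.symm i : ℕ) % 5 = 2 := fun i => hSmod _ (g.symm i).2
  refine ⟨k, Sum.elim f (fun i => (g.symm i : ℕ)), ?_, ?_, ?_⟩
  · rintro (a | i) (b | j) h
    · exact congrArg _ (hf h)
    · have := hmod a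
      have := hg j
      simp only [Sum.elim_inl, Sum.elim_inr] at h
      omega
    · have := hmod b
      have := hg i
      simp only [Sum.elim_inl, Sum.elim_inr] at h
      omega
    · exact congrArg _ (g.symm.injective (Subtype.ext h))
  · rintro (a | i)
    · have := hmod a
      simp only [Sum.elim_inl]
      omega
    · have := hg i
      simp only [Sum.elim_inr]
      omega
  · rintro (a | i) (b | j)
    · simp only [SimpleGraph.addIsolates, SimpleGraph.sum_adj_inl, Sum.elim_inl]
      constructor
      · intro h
        refine ⟨fun h' => h.ne (Sum.inl_injective h'), Sum.inr (g ⟨f a + f b, a, b, h, rfl⟩), ?_⟩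
        simp
      · rintro ⟨hab, c | m, h⟩
        · have := hmod a
          have := hmod b
          have := hmod c
          simp only [Sum.elim_inl] at h
          omega
        · obtain ⟨c, d, hcd, hm⟩ := (g.symm m).2
          simp only [Sum.elim_inr] at h
          rcases hsidon a b c d (fun h' => hab (congrArg _ h')) (by omega) with
            ⟨rfl, rfl⟩ | ⟨rfl, rfl⟩
          · exact hcd
          · exact hcd.symm
    all_goals
      simp only [SimpleGraph.addIsolates, SimpleGraph.sum_adj, Sum.elim_inl, Sum.elim_inr,
        SimpleGraph.bot_adj, false_iff]
      rintro ⟨-, c | m, h⟩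
    all_goals simp only [Sum.elim_inl, Sum.elim_inr] at h
    · have := hmod a
      have := hg j
      have := hmod c
      omega
    · have := hmod a
      have := hg j
      have := hg m
      omega
    · have := hg i
      have := hmod b
      have := hmod c
      omega
    · have := hg i
      have := hmod b
      have := hg m
      omega
    · have := hg i
      have := hg j
      have := hmod c
      omega
    · have := hg i
      have := hg j
      have := hg m
      omega

/-- The sum number of a finite graph: the least number of isolated vertices that have to be added
to it in order to obtain a sum graph. -/
noncomputable def SimpleGraph.sumNumber {V : Type u} (G : SimpleGraph V) : ℕ :=
  sInf {k : ℕ | (G.addIsolates k).IsSumGraph}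

/-! **Upper bounds.** Label a path by consecutive terms of a generalized Fibonacci sequence `A`,
`B`, `A + B`, …; the next term is the sum on the last edge and labels a single isolate. A cycle
needs one more isolate, for its closing edge. Components are stacked: each one is placed above the
labelling built so far and takes over its two isolates as its own first two vertices, so that
there are never more than two isolates. The cycle `C₄` does not fit this pattern; it is added to
an existing labelling, scaled by `4`, such that the sums on its four edges are existing labels,
which form a parallelogram. A path on top merges the two isolates into one, which settles the case
of minimum degree one.

**Lower bounds.** The sums on the edges at a vertex with the largest label are distinct labels of
isolates, whence `δ ≤ σ`. In a sum labelling of `C₄ + K`, call `3` the vertex of `C₄` with the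
largest label, and `2` the one of its neighbours with the smaller label. Then the sums on the
edges `12`, `23` and `30` are labels of `K`, and the first two cannot add up to the third, as this
would yield an edge between `C₄` and `K`. So `K` has at least three vertices, and at least four if
it has an edge. -/

namespace SumGraph

open SimpleGraph

section Labelling

variable {V W : Type*} {G : SimpleGraph V} {H : SimpleGraph W} {l : V → ℕ} {g : W → ℕ}
  {P Q : Finset ℕ} {A B C D : ℕ}

/-- The set of all labels of a graph with added isolates, whose own vertices are labelled by `l`
and whose isolates are identified with their labels, the elements of `P`. -/
def labels (l : V → ℕ) (P : Finset ℕ) : Set ℕ :=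
  Set.range l ∪ P

theorem mem_labels {n : ℕ} : n ∈ labels l P ↔ (∃ v, l v = n) ∨ n ∈ P :=
  Iff.rfl

theorem apply_mem_labels (v : V) : l v ∈ labels l P :=
  Or.inl ⟨v, rfl⟩

theorem mem_labels_of_mem {p : ℕ} (hp : p ∈ P) : p ∈ labels l P :=
  Or.inr hp

theorem mem_labels_pair {n : ℕ} : n ∈ labels l {A, B} ↔ (∃ v, l v = n) ∨ n = A ∨ n = B := by
  rw [mem_labels, Finset.mem_insert, Finset.mem_singleton]

theorem labels_pair : labels l {A, B} = insert A (labels l {B}) := by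
  ext n
  rw [mem_labels_pair, Set.mem_insert_iff, mem_labels, Finset.mem_singleton, or_left_comm]

theorem labels_comp_equiv (e : W ≃ V) : labels (l ∘ e) P = labels l P := by
  rw [labels, labels, e.surjective.range_comp]

theorem labels_sumElim : labels (Sum.elim g l) Q = labels g Q ∪ Set.range l := by
  rw [labels, labels, Set.Sum.elim_range, Set.union_right_comm]

/-- A sum labelling of `G` together with isolates, in which the vertices of `G` are labelled by `l`
and the isolates by the elements of `P`. -/
structure SumLabellingWith (G : SimpleGraph V) (l : V → ℕ) (P : Finset ℕ) : Prop where
  injective : Function.Injective l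
  pos : ∀ n ∈ labels l P, 0 < n
  notMem : ∀ v, l v ∉ P
  adj_iff : ∀ x y, G.Adj x y ↔ x ≠ y ∧ l x + l y ∈ labels l P
  add_notMem : ∀ m ∈ labels l P, ∀ p ∈ P, m ≠ p → m + p ∉ labels l P

namespace SumLabellingWith

theorem comp_iso (h : SumLabellingWith G l P) (e : H ≃g G) : SumLabellingWith H (l ∘ e) P where
  injective := h.injective.comp e.injective
  pos := labels_comp_equiv (l := l) e.toEquiv ▸ h.pos
  notMem v := h.notMem (e v)
  adj_iff x y := by
    rw [← e.map_adj_iff, h.adj_iff, e.injective.ne_iff]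
    exact and_congr_right' (labels_comp_equiv (l := l) e.toEquiv ▸ Iff.rfl)
  add_notMem := labels_comp_equiv (l := l) e.toEquiv ▸ h.add_notMem

theorem isSumGraph (h : SumLabellingWith G l P) : (G.addIsolates P.card).IsSumGraph := by
  let i : Fin P.card → ℕ := fun j => P.equivFin.symm j
  have i_mem (j) : i j ∈ P := (P.equivFin.symm j).2
  have i_inj : Function.Injective i := Subtype.val_injective.comp P.equivFin.symm.injective
  have range_eq : Set.range (Sum.elim l i) = labels l P := by
    rw [Set.Sum.elim_range, labels, Set.range_comp' Subtype.val, P.equivFin.symm.range_eq_univ,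
      Set.image_univ, Subtype.range_coe]
  have exists_iff (n) : (∃ z, Sum.elim l i z = n) ↔ n ∈ labels l P := range_eq ▸ Iff.rfl
  refine ⟨Sum.elim l i, h.injective.sumElim i_inj fun v j hvj => h.notMem v (hvj ▸ i_mem j),
    fun v => h.pos _ ((exists_iff _).1 ⟨v, rfl⟩), ?_⟩
  rintro (x | x) (y | y) <;> rw [exists_iff]
  · simpa only [addIsolates, sum_adj_inl, Sum.inl_injective.ne_iff, Sum.elim_inl] using
      h.adj_iff x y
  · simpa [addIsolates] using
      h.add_notMem _ (apply_mem_labels x) _ (i_mem y) fun hxy => h.notMem x (hxy ▸ i_mem y)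
  · simpa [addIsolates, add_comm] using
      h.add_notMem _ (apply_mem_labels y) _ (i_mem x) fun hxy => h.notMem y (hxy ▸ i_mem x)
  · simpa [addIsolates] using fun hxy =>
      h.add_notMem _ (mem_labels_of_mem (i_mem x)) _ (i_mem y) (i_inj.ne hxy)

theorem sumNumber_le (h : SumLabellingWith G l P) : G.sumNumber ≤ P.card :=
  Nat.sInf_le h.isSumGraph

end SumLabellingWith

/-- A sum labelling of `G` with exactly two isolates `A > B`, which carry the two largest labels.
Such a labelling is ready to be glued below another one, see `CappedLabelling.glue`; the condition
`A ≠ 2 * B` is needed when the latter labels a cycle. -/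
structure CappedLabelling (G : SimpleGraph V) (l : V → ℕ) (A B : ℕ) : Prop
    extends SumLabellingWith G l {A, B} where
  lt : ∀ v, l v < B
  cap_lt : B < A
  cap_ne : A ≠ 2 * B

/-- A set of labels that can be placed above a labelling capped by `A` and `B`. The gaps ensure that
a label below `B` is never the difference of two elements of `S`, except possibly when it is
`A - B`, which a labelling capped by `A` and `B` does not use. -/
structure IsGluable (A B : ℕ) (S : Set ℕ) : Prop where
  fst_mem : A ∈ S
  snd_mem : B ∈ S
  cases : ∀ n ∈ S, n = A ∨ n = B ∨ A + B ≤ n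
  gap : ∀ m ∈ S, ∀ n ∈ S, m < n → m + B ≤ n ∨ m + A = n + B

namespace CappedLabelling

theorem of_isEmpty [IsEmpty V] (G : SimpleGraph V) (l : V → ℕ) : CappedLabelling G l 3 1 where
  injective := Function.injective_of_subsingleton l
  pos := by simp [labels]
  notMem := isEmptyElim
  adj_iff := isEmptyElim
  add_notMem := by simp [labels]
  lt := isEmptyElim
  cap_lt := by norm_num
  cap_ne := by norm_num

theorem of_singleton (h : SumLabellingWith G l {A}) (hl : ∀ v, l v < A) :
    CappedLabelling G l (4 * A) A := by
  have hA : 0 < A := h.pos A (mem_labels_of_mem (Finset.mem_singleton_self A))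
  have le_cap : ∀ n ∈ labels l {A}, n ≤ A := by
    rintro n (⟨v, rfl⟩ | hn)
    exacts [(hl v).le, (Finset.mem_singleton.1 hn).le]
  refine ⟨⟨h.injective, ?_, ?_, ?_, ?_⟩, hl, by omega, by omega⟩
  · rw [labels_pair]
    rintro n (rfl | hn)
    exacts [by omega, h.pos n hn]
  · intro v
    have := hl v
    simp only [Finset.mem_insert, Finset.mem_singleton]
    omega
  · intro x y
    rw [h.adj_iff, labels_pair, Set.mem_insert_iff, or_iff_right]
    have := hl x
    have := hl y
    omega
  · have sum_notMem : ∀ n, 4 * A < n → n ∉ insert (4 * A) (labels l {A}) := by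
      rintro n hlt (rfl | hn)
      · omega
      · have := le_cap n hn
        omega
    simp only [labels_pair, Finset.mem_insert, Finset.mem_singleton]
    rintro m (rfl | hm) p (rfl | rfl) hmp
    · exact absurd rfl hmp
    · exact sum_notMem _ (by omega)
    · have := h.pos m hm
      exact sum_notMem _ (by omega)
    · rintro (hn | hn)
      · have := le_cap m hm
        omega
      · exact h.add_notMem m hm p (Finset.mem_singleton_self p) hmp hn

theorem le_of_mem_labels (h : CappedLabelling G l A B) {n : ℕ} (hn : n ∈ labels l {A, B}) :
    n = A ∨ n ≤ B := by
  rcases mem_labels_pair.1 hn with ⟨v, rfl⟩ | rfl | rfl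
  exacts [Or.inr (h.lt v).le, Or.inl rfl, Or.inr le_rfl]

theorem snd_le_of_isGluable (h : CappedLabelling G l A B) {S : Set ℕ} (hS : IsGluable A B S) {n : ℕ}
    (hn : n ∈ S) : B ≤ n := by
  have := h.cap_lt
  rcases hS.cases n hn with rfl | rfl | hn <;> omega

theorem add_notMem_of_isGluable (h : CappedLabelling G l A B) {S : Set ℕ} (hS : IsGluable A B S)
    {m : ℕ} (hm : m ∈ S) (v : V) : m + l v ∉ S ∪ Set.range l := by
  have hv := h.lt v
  have hv₀ := h.pos _ (apply_mem_labels v)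
  rintro (hn | ⟨z, hz⟩)
  · rcases hS.gap m hm _ hn (by omega) with hgap | hgap
    · omega
    · refine h.add_notMem (l v) (apply_mem_labels v) B (by simp) hv.ne (Or.inr ?_)
      simp only [Finset.coe_insert, Finset.coe_singleton, Set.mem_insert_iff]
      omega
  · have := h.snd_le_of_isGluable hS hm
    have := h.lt z
    omega

theorem add_mem_iff_of_isGluable (h : CappedLabelling G l A B) {S : Set ℕ} (hS : IsGluable A B S)
    (x y : V) : l x + l y ∈ S ↔ l x + l y = A ∨ l x + l y = B := by
  refine ⟨fun hn => ?_, ?_⟩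
  · have := hS.cases _ hn
    have := h.lt x
    have := h.lt y
    have := h.cap_lt
    omega
  · rintro (hn | hn) <;> rw [hn]
    exacts [hS.fst_mem, hS.snd_mem]

theorem glue (h : CappedLabelling G l A B) (h' : SumLabellingWith H g Q)
    (hS : IsGluable A B (labels g Q)) : SumLabellingWith (H ⊕g G) (Sum.elim g l) Q := by
  have cap_le {n} (hn : n ∈ labels g Q) : B ≤ n := h.snd_le_of_isGluable hS hn
  have mixed {m} (hm : m ∈ labels g Q) (v) : m + l v ∉ labels g Q ∪ Set.range l :=
    h.add_notMem_of_isGluable hS hm v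
  have upper {m n} (hm : m ∈ labels g Q) (_ : n ∈ labels g Q) : m + n ∉ Set.range l := by
    rintro ⟨z, hz⟩
    have := cap_le hm
    have := h.lt z
    omega
  refine ⟨?_, ?_, ?_, ?_, ?_⟩
  · refine h'.injective.sumElim h.injective fun w v hwv => ?_
    exact ((h.lt v).trans_le (cap_le (apply_mem_labels w))).ne' hwv
  · rw [labels_sumElim]
    rintro n (hn | ⟨v, rfl⟩)
    exacts [h'.pos n hn, h.pos _ (apply_mem_labels v)]
  · rintro (w | v)
    exacts [h'.notMem w, fun hv => (h.lt v).not_ge (cap_le (mem_labels_of_mem hv))]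
  · rw [labels_sumElim]
    rintro (x | x) (y | y)
    · simp only [sum_adj_inl, Sum.elim_inl, h'.adj_iff, Sum.inl_injective.ne_iff, Set.mem_union,
        or_iff_left (upper (apply_mem_labels x) (apply_mem_labels y))]
    · simpa using mixed (apply_mem_labels x) y
    · simpa [add_comm] using mixed (apply_mem_labels y) x
    · rw [sum_adj_inr, h.adj_iff, Sum.inr_injective.ne_iff, Set.mem_union, Sum.elim_inr,
        Sum.elim_inr, h.add_mem_iff_of_isGluable hS, mem_labels_pair, Set.mem_range, or_comm]
  · rw [labels_sumElim]
    rintro m (hm | ⟨v, rfl⟩) p hp hmp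
    · rintro (hn | hn)
      exacts [h'.add_notMem m hm p hp hmp hn, upper hm (mem_labels_of_mem hp) hn]
    · rw [add_comm]
      exact mixed (mem_labels_of_mem hp) v

theorem glue_capped (h : CappedLabelling G l A B) (h' : CappedLabelling H g C D)
    (hS : IsGluable A B (labels g {C, D})) : CappedLabelling (H ⊕g G) (Sum.elim g l) C D where
  toSumLabellingWith := h.glue h'.toSumLabellingWith hS
  lt := by
    have hD : D ∈ labels g {C, D} := mem_labels_of_mem (by simp)
    rintro (w | v)
    exacts [h'.lt w, (h.lt v).trans_le (h.snd_le_of_isGluable hS hD)]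
  cap_lt := h'.cap_lt
  cap_ne := h'.cap_ne

end CappedLabelling

end Labelling

section Gib

variable {A B i j k n m : ℕ}

/-- The generalized Fibonacci sequence with initial terms `A` and `B`; it provides the labels of
paths and cycles. It is used for `B < A`, so that it increases only from index `1` on. -/
def gib (A B : ℕ) : ℕ → ℕ
  | 0 => A
  | 1 => B
  | n + 2 => gib A B n + gib A B (n + 1)

theorem gib_zero : gib A B 0 = A := rfl

theorem gib_one : gib A B 1 = B := rfl

theorem gib_add_two (n : ℕ) : gib A B (n + 2) = gib A B n + gib A B (n + 1) := rfl

theorem le_gib (hBA : B < A) : ∀ n, B ≤ gib A B n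
  | 0 => hBA.le
  | 1 => le_rfl
  | n + 2 => (le_gib hBA (n + 1)).trans (Nat.le_add_left _ _)

theorem gib_add_le (hBA : B < A) (hj : 2 ≤ j) (hij : i < j) : gib A B i + B ≤ gib A B j := by
  induction j, hj using Nat.le_induction with
  | base => interval_cases i <;> simp only [gib] <;> omega
  | succ j hj ih =>
    obtain ⟨j, rfl⟩ := Nat.exists_eq_add_of_le' (show 1 ≤ j by omega)
    have := le_gib hBA j
    rw [gib_add_two]
    rcases (Nat.lt_succ_iff.1 hij).eq_or_lt with rfl | hij
    · omega
    · have := ih hij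
      omega

theorem add_le_gib (hBA : B < A) (hj : 2 ≤ j) : A + B ≤ gib A B j :=
  gib_add_le hBA hj (show 0 < j by omega)

theorem gib_lt_gib (hB : 0 < B) (hBA : B < A) (hj : 2 ≤ j) (hij : i < j) :
    gib A B i < gib A B j := by
  have := gib_add_le hBA hj hij
  omega

theorem gib_le_gib (hB : 0 < B) (hBA : B < A) (hj : 2 ≤ j) (hij : i ≤ j) :
    gib A B i ≤ gib A B j := by
  rcases hij.eq_or_lt with rfl | hij
  exacts [le_rfl, (gib_lt_gib hB hBA hj hij).le]

theorem gib_injective (hB : 0 < B) (hBA : B < A) : Function.Injective (gib A B) := by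
  refine Function.injective_iff_pairwise_ne.2 fun i j hij => ?_
  wlog h : i < j generalizing i j
  · exact (this j i hij.symm (by omega)).symm
  rcases Nat.lt_or_ge j 2 with hj | hj
  · obtain ⟨rfl, rfl⟩ : i = 0 ∧ j = 1 := by omega
    exact hBA.ne'
  · exact (gib_lt_gib hB hBA hj h).ne

theorem gib_cases (hBA : B < A) : ∀ n, gib A B n = A ∨ gib A B n = B ∨ A + B ≤ gib A B n
  | 0 => Or.inl rfl
  | 1 => Or.inr (Or.inl rfl)
  | n + 2 => Or.inr (Or.inr (add_le_gib hBA (Nat.le_add_left 2 n)))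

theorem gib_gap (hB : 0 < B) (hBA : B < A) (hij : gib A B i < gib A B j) :
    gib A B i + B ≤ gib A B j ∨ gib A B i + A = gib A B j + B := by
  rcases Nat.lt_or_ge j 2 with hj | hj
  · have := gib_cases hBA i
    interval_cases j <;> simp only [gib] at hij ⊢ <;> omega
  · left
    refine gib_add_le hBA hj (lt_of_not_ge fun hji => ?_)
    have := gib_le_gib hB hBA (hj.trans hji) hji
    omega

theorem gib_ne_of_between (hB : 0 < B) (hBA : B < A) (hj : 2 ≤ j) (hlt : gib A B j < m)
    (hlt' : m < gib A B (j + 1)) : m ≠ gib A B k := by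
  rcases Nat.lt_or_ge j k with hjk | hjk
  · exact (hlt'.trans_le (gib_le_gib hB hBA (by omega) hjk)).ne
  · exact ((gib_le_gib hB hBA hj hjk).trans_lt hlt).ne'

theorem gib_add_eq_gib (hB : 0 < B) (hBA : B < A) (hij : i < j)
    (h : gib A B i + gib A B j = gib A B k) : j = i + 1 ∧ k = i + 2 := by
  have hi := le_gib hBA i
  rcases (Nat.succ_le_of_lt hij).eq_or_lt with rfl | hij'
  · exact ⟨rfl, gib_injective hB hBA (h.symm.trans (gib_add_two i).symm)⟩
  obtain ⟨j, rfl⟩ := Nat.exists_eq_add_of_le' (show 1 ≤ j by omega)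
  exfalso
  by_cases hj : i = 0 ∧ j = 1
  · obtain ⟨rfl, rfl⟩ := hj
    refine gib_ne_of_between hB hBA (j := 3) (by omega) ?_ ?_ h <;> simp only [gib] <;> omega
  · refine gib_ne_of_between hB hBA (j := j + 1) (by omega) (by omega) ?_ h
    have := gib_lt_gib hB hBA (show 2 ≤ j by omega) (show i < j by omega)
    rw [gib_add_two]
    omega

theorem gib_add_mem_image_Iic (hB : 0 < B) (hBA : B < A) (hij : i < j) (hj : j < n) :
    gib A B i + gib A B j ∈ gib A B '' Set.Iic n ↔ i + 1 = j := by
  constructor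
  · rintro ⟨k, -, hk⟩
    exact (gib_add_eq_gib hB hBA hij hk.symm).1.symm
  · rintro rfl
    exact ⟨i + 2, hj, rfl⟩

theorem gib_add_gib_notMem_image_Iic (hB : 0 < B) (hBA : B < A) (hi : i < n) :
    gib A B i + gib A B n ∉ gib A B '' Set.Iic n := by
  rintro ⟨k, hkn, hk⟩
  have := gib_add_eq_gib hB hBA hi hk.symm
  simp only [Set.mem_Iic] at hkn
  omega

theorem isGluable_gib (hB : 0 < B) (hBA : B < A) (hn : 1 ≤ n) :
    IsGluable A B (gib A B '' Set.Iic n) where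
  fst_mem := ⟨0, Nat.zero_le n, rfl⟩
  snd_mem := ⟨1, hn, rfl⟩
  cases := by
    rintro _ ⟨i, -, rfl⟩
    exact gib_cases hBA i
  gap := by
    rintro _ ⟨i, -, rfl⟩ _ ⟨j, -, rfl⟩
    exact gib_gap hB hBA

theorem isGluable_insert_gib (hB : 0 < B) (hBA : B < A) (m : ℕ) :
    IsGluable A B (insert (A + gib A B (m + 2)) (gib A B '' Set.Iic (m + 3))) := by
  have hS := isGluable_gib hB hBA (n := m + 3) (by omega)
  have recursion : gib A B (m + 3) = gib A B (m + 1) + gib A B (m + 2) := rfl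
  have bound : B ≤ gib A B (m + 2) := le_gib hBA _
  have le_or_eq {i} (hi : i ∈ Set.Iic (m + 3)) : gib A B i ≤ gib A B (m + 2) ∨ i = m + 3 := by
    rw [Set.mem_Iic] at hi
    rcases hi.eq_or_lt with rfl | hi
    exacts [Or.inr rfl, Or.inl (gib_le_gib hB hBA (by omega) (by omega))]
  have size := gib_cases hBA (m + 1)
  refine ⟨Or.inr hS.fst_mem, Or.inr hS.snd_mem, ?_, ?_⟩
  · rintro n (rfl | hn)
    exacts [by omega, hS.cases n hn]
  · rintro x (rfl | hx) y (rfl | hy) hxy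
    · omega
    · obtain ⟨j, hj, rfl⟩ := hy
      rcases le_or_eq hj with hj | rfl <;> omega
    · obtain ⟨i, hi, rfl⟩ := hx
      rcases le_or_eq hi with hi | rfl <;> omega
    · exact hS.gap x hx y hy hxy

theorem gib_ne_two_mul (hB : 0 < B) (hBA : B < A) (hA : A ≠ 2 * B) (n : ℕ) :
    gib A B n ≠ 2 * A := by
  rcases Nat.lt_or_ge n 4 with hn | hn
  · interval_cases n <;> simp only [gib] <;> omega
  · have : gib A B 4 ≤ gib A B n := gib_le_gib hB hBA (by omega) hn
    simp only [gib] at this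
    omega

end Gib

section PathsAndCycles

variable {V : Type*} {G : SimpleGraph V} {l : V → ℕ} {A B C D m : ℕ}

theorem adj_iff_of_lt [LinearOrder V] {S : Set ℕ}
    (h : ∀ x y, x < y → (G.Adj x y ↔ l x + l y ∈ S)) (x y : V) :
    G.Adj x y ↔ x ≠ y ∧ l x + l y ∈ S := by
  rcases lt_trichotomy x y with hxy | rfl | hxy
  · rw [h x y hxy, and_iff_right hxy.ne]
  · simp
  · rw [G.adj_comm, h y x hxy, add_comm, and_iff_right hxy.ne']

theorem labels_gib (A B n : ℕ) :
    labels (fun i : Fin n => gib A B i) {gib A B n} = gib A B '' Set.Iic n := by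
  ext k
  simp only [mem_labels, Finset.mem_singleton, Set.mem_image, Set.mem_Iic]
  constructor
  · rintro (⟨i, rfl⟩ | rfl)
    exacts [⟨i, i.2.le, rfl⟩, ⟨n, le_rfl, rfl⟩]
  · rintro ⟨i, hi, rfl⟩
    rcases hi.eq_or_lt with rfl | hi
    exacts [Or.inr rfl, Or.inl ⟨⟨i, hi⟩, rfl⟩]

theorem labels_gib_pair (A B n C : ℕ) :
    labels (fun i : Fin n => gib A B i) {gib A B n, C} = insert C (gib A B '' Set.Iic n) := by
  rw [Finset.pair_comm, labels_pair, labels_gib]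

theorem sumLabellingWith_pathGraph (hB : 0 < B) (hBA : B < A) (n : ℕ) :
    SumLabellingWith (pathGraph n) (fun i => gib A B i) {gib A B n} where
  injective := (gib_injective hB hBA).comp Fin.val_injective
  pos := by
    rw [labels_gib]
    rintro _ ⟨i, -, rfl⟩
    exact hB.trans_le (le_gib hBA i)
  notMem i hi := i.2.ne (gib_injective hB hBA (Finset.mem_singleton.1 hi))
  adj_iff := by
    refine adj_iff_of_lt fun i j hij => ?_
    have : (i : ℕ) < j := hij
    rw [labels_gib, gib_add_mem_image_Iic hB hBA hij j.2, pathGraph_adj]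
    omega
  add_notMem := by
    simp only [labels_gib, Finset.mem_singleton]
    rintro _ ⟨i, hi, rfl⟩ _ rfl hne
    exact gib_add_gib_notMem_image_Iic hB hBA (hi.lt_of_ne (mt (congrArg _) hne))

theorem cycleGraph_adj_of_lt {i j : Fin (m + 3)} (hij : i < j) :
    (cycleGraph (m + 3)).Adj i j ↔ (i : ℕ) + 1 = j ∨ ((i : ℕ) = 0 ∧ (j : ℕ) = m + 2) := by
  rw [cycleGraph_adj', Fin.sub_val_of_le hij.le, Fin.coe_sub_iff_lt.2 hij]
  have : (i : ℕ) < j := hij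
  omega

theorem gib_add_gib_eq_closing_iff (hB : 0 < B) (hBA : B < A) {i j : ℕ} (hij : i < j)
    (hj : j ≤ m + 2) : gib A B i + gib A B j = A + gib A B (m + 2) ↔ i = 0 ∧ j = m + 2 := by
  refine ⟨fun h => ?_, by rintro ⟨rfl, rfl⟩; rfl⟩
  rcases hj.eq_or_lt with rfl | hj
  · exact ⟨gib_injective hB hBA (Nat.add_right_cancel h), rfl⟩
  · have hjm := gib_lt_gib hB hBA (by omega) hj
    exfalso
    rcases Nat.lt_or_ge i 2 with hi | hi
    · interval_cases i <;> simp only [gib_zero, gib_one] at h <;> omega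
    · obtain ⟨j, rfl⟩ := Nat.exists_eq_add_of_le' (show 1 ≤ j by omega)
      have := gib_le_gib hB hBA (by omega) (show i ≤ j by omega)
      have : gib A B (j + 2) ≤ gib A B (m + 2) := gib_le_gib hB hBA (by omega) (by omega)
      rw [gib_add_two] at this
      omega

theorem gib_add_gib_ne_closing (hB : 0 < B) (hBA : B < A) (hA : A ≠ 2 * B) {i : ℕ}
    (hi : i < m + 3) : gib A B i + gib A B (m + 3) ≠ A + gib A B (m + 2) := by
  intro h
  have recursion : gib A B (m + 3) = gib A B (m + 1) + gib A B (m + 2) := rfl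
  have hi₁ : gib A B i + gib A B (m + 1) = A := by omega
  have := le_gib hBA i
  obtain rfl : m = 0 := by
    by_contra hm
    have := add_le_gib hBA (show 2 ≤ m + 1 by omega)
    omega
  have := gib_cases hBA i
  simp only [gib] at hi₁
  omega

theorem gib_add_closing_notMem (hB : 0 < B) (hBA : B < A) (hA : A ≠ 2 * B) (hm : m ≠ 1) (i : ℕ) :
    gib A B i + (A + gib A B (m + 2)) ∉ gib A B '' Set.Iic (m + 3) := by
  rintro ⟨k, hk, h⟩
  have hi := le_gib hBA i
  obtain rfl : k = m + 3 := by
    by_contra hne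
    have := gib_le_gib hB hBA (by omega) (show k ≤ m + 2 from Nat.le_of_lt_succ (hk.lt_of_ne hne))
    omega
  have recursion : gib A B (m + 3) = gib A B (m + 1) + gib A B (m + 2) := rfl
  have hi₀ : gib A B 0 + gib A B i = gib A B (m + 1) := by
    rw [gib_zero]
    omega
  rcases Nat.eq_zero_or_pos i with rfl | hi
  · exact gib_ne_two_mul hB hBA hA (m + 1) (by rw [← hi₀, gib_zero, two_mul])
  · have := gib_add_eq_gib hB hBA hi hi₀
    omega

theorem sumLabellingWith_cycleGraph (hB : 0 < B) (hBA : B < A) (hA : A ≠ 2 * B) (hm : m ≠ 1) :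
    SumLabellingWith (cycleGraph (m + 3)) (fun i => gib A B i)
      {gib A B (m + 3), A + gib A B (m + 2)} where
  injective := (gib_injective hB hBA).comp Fin.val_injective
  pos := by
    rw [labels_gib_pair]
    rintro _ (rfl | ⟨i, -, rfl⟩)
    exacts [by omega, hB.trans_le (le_gib hBA i)]
  notMem i hi := by
    simp only [Finset.mem_insert, Finset.mem_singleton] at hi
    have := gib_lt_gib hB hBA (by omega) i.2
    have := gib_le_gib hB hBA (by omega) (Nat.le_of_lt_succ i.2)
    omega
  adj_iff := by
    refine adj_iff_of_lt fun i j hij => ?_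
    rw [cycleGraph_adj_of_lt hij, labels_gib_pair, Set.mem_insert_iff,
      gib_add_mem_image_Iic hB hBA hij j.2,
      gib_add_gib_eq_closing_iff hB hBA hij (Nat.le_of_lt_succ j.2), or_comm]
  add_notMem := by
    have recursion : gib A B (m + 3) = gib A B (m + 1) + gib A B (m + 2) := rfl
    have top_le : ∀ k ∈ Set.Iic (m + 3), gib A B k ≤ gib A B (m + 3) := fun k hk =>
      gib_le_gib hB hBA (by omega) hk
    simp only [labels_gib_pair, Finset.mem_insert, Finset.mem_singleton]
    rintro n (rfl | ⟨i, hi, rfl⟩) p (rfl | rfl) hne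
    · rintro (h | ⟨k, hk, h⟩)
      · have := le_gib hBA (m + 3)
        omega
      · have := top_le k hk
        omega
    · exact absurd rfl hne
    · have hi' : i < m + 3 := lt_of_le_of_ne hi (mt (congrArg _) hne)
      rintro (h | h)
      exacts [gib_add_gib_ne_closing hB hBA hA hi' h, gib_add_gib_notMem_image_Iic hB hBA hi' h]
    · have := le_gib hBA i
      rintro (h | h)
      exacts [by omega, gib_add_closing_notMem hB hBA hA hm i h]

theorem CappedLabelling.exists_of_pair (h : SumLabellingWith G l {C, D}) (hC : ∀ v, l v < C)
    (hD : ∀ v, l v < D) (hne : C ≠ D) (hCD : C < 2 * D) (hDC : D < 2 * C) :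
    ∃ A B, CappedLabelling G l A B ∧ ({A, B} : Finset ℕ) = {C, D} := by
  rcases hne.lt_or_gt with hlt | hlt
  · exact ⟨D, C, ⟨Finset.pair_comm C D ▸ h, hC, hlt, hDC.ne⟩, Finset.pair_comm D C⟩
  · exact ⟨C, D, ⟨h, hD, hlt, hCD.ne⟩, rfl⟩

theorem exists_cappedLabelling_cycleGraph (hB : 0 < B) (hBA : B < A) (hA : A ≠ 2 * B)
    (hm : m ≠ 1) : ∃ C D, CappedLabelling (cycleGraph (m + 3)) (fun i => gib A B i) C D ∧
      labels (fun i : Fin (m + 3) => gib A B i) {C, D} =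
        insert (A + gib A B (m + 2)) (gib A B '' Set.Iic (m + 3)) := by
  have recursion : gib A B (m + 3) = gib A B (m + 1) + gib A B (m + 2) := rfl
  have recursion' : gib A B (m + 2) = gib A B m + gib A B (m + 1) := rfl
  have := gib_cases hBA (m + 1)
  have := add_le_gib hBA (show 2 ≤ m + 2 by omega)
  have lt_top (i : Fin (m + 3)) := gib_lt_gib hB hBA (show 2 ≤ m + 3 by omega) i.2
  have le_closing (i : Fin (m + 3)) : gib A B i ≤ gib A B (m + 2) :=
    gib_le_gib hB hBA (by omega) (Nat.le_of_lt_succ i.2)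
  have ne_closing : gib A B (m + 3) ≠ A + gib A B (m + 2) := by
    have : gib A B (m + 1) ≠ gib A B 0 := (gib_injective hB hBA).ne (Nat.succ_ne_zero m)
    rw [gib_zero] at this
    omega
  obtain ⟨C, D, h, hCD⟩ := CappedLabelling.exists_of_pair
    (sumLabellingWith_cycleGraph hB hBA hA hm) lt_top (fun i => by have := le_closing i; omega)
    ne_closing (by omega) (by omega)
  exact ⟨C, D, h, by rw [hCD, labels_gib_pair]⟩

end PathsAndCycles

section Quad

variable {V W : Type*} {G : SimpleGraph V} {H : SimpleGraph W} {l : V → ℕ} {g : W → ℕ}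
  {P : Finset ℕ} {L L' : Set ℕ} {A B C D m n p s t : ℕ}

/-- A parallelogram `p`, `p + s`, `p + t`, `p + s + t` in a set of labels, possibly degenerate with
`s = t`, whose side lengths are not labels. Its corners serve as the sums along the edges of a
`4`-cycle that can be added to the labelled graph without further isolates. -/
structure IsQuad (L : Set ℕ) (p s t : ℕ) : Prop where
  fst_pos : 0 < s
  snd_pos : 0 < t
  corner_mem : p ∈ L
  add_fst_mem : p + s ∈ L
  add_snd_mem : p + t ∈ L
  add_add_mem : p + s + t ∈ L
  fst_notMem : s ∉ L
  snd_notMem : t ∉ L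

theorem IsQuad.corner_pos (h : IsQuad L p s t) : 0 < p := by
  refine Nat.pos_of_ne_zero fun hp => h.fst_notMem ?_
  simpa only [hp, zero_add] using h.add_fst_mem

theorem IsQuad.mono (h : IsQuad L p s t) (hL : L ⊆ L') (hle : ∀ n ∈ L', n ∉ L → ∀ m ∈ L, m ≤ n) :
    IsQuad L' p s t := by
  have hp := h.corner_pos
  refine ⟨h.fst_pos, h.snd_pos, hL h.corner_mem, hL h.add_fst_mem, hL h.add_snd_mem,
    hL h.add_add_mem, fun hs => ?_, fun ht => ?_⟩
  · have := hle s hs h.fst_notMem _ h.add_fst_mem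
    omega
  · have := hle t ht h.snd_notMem _ h.add_snd_mem
    omega

theorem CappedLabelling.isQuad_glue (h : CappedLabelling G l A B) {Q : Finset ℕ}
    (hS : IsGluable A B (labels g Q)) (hq : IsQuad (labels l {A, B}) p s t) :
    IsQuad (labels (Sum.elim g l) Q) p s t := by
  have := h.cap_lt
  rw [labels_sumElim]
  refine hq.mono ?_ ?_
  · intro n hn
    rcases mem_labels_pair.1 hn with hn | rfl | rfl
    exacts [Or.inr hn, Or.inl hS.fst_mem, Or.inl hS.snd_mem]
  · rintro n (hn | ⟨v, rfl⟩) hnL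
    · have hAn : A + B ≤ n := by
        rcases hS.cases n hn with rfl | rfl | hn
        exacts [absurd (mem_labels_of_mem (by simp)) hnL,
          absurd (mem_labels_of_mem (by simp)) hnL, hn]
      intro m hm
      have := h.le_of_mem_labels hm
      omega
    · exact absurd (apply_mem_labels v) hnL

theorem IsGluable.isQuad (hL : IsGluable 3 1 L) (h5 : 5 ∈ L) : IsQuad L 1 2 2 := by
  have h2 : 2 ∉ L := fun h => by
    have := hL.cases 2 h
    omega
  exact ⟨two_pos, two_pos, hL.snd_mem, hL.fst_mem, hL.fst_mem, h5, h2, h2⟩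

/-- The labels of a `4`-cycle added below a quad, all other labels being multiplied by `4`. They are
odd, and consecutive ones add up to `4` times a corner of the quad. -/
def quadLabel (p s t : ℕ) : Fin 4 → ℕ :=
  ![1, 4 * p - 1, 4 * t + 1, 4 * (p + s) - 1]

theorem mem_range_quadLabel : n ∈ Set.range (quadLabel p s t) ↔
    n = 1 ∨ n = 4 * p - 1 ∨ n = 4 * t + 1 ∨ n = 4 * (p + s) - 1 := by
  rw [Set.mem_range, Fin.exists_fin_succ, Fin.exists_fin_succ, Fin.exists_fin_two]
  simp [quadLabel, eq_comm]

theorem labels_quadLabel : labels (Sum.elim (quadLabel p s t) fun v => 4 * l v) (P.image (4 * ·)) =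
    (4 * ·) '' labels l P ∪ Set.range (quadLabel p s t) := by
  rw [labels, labels, Set.Sum.elim_range, Set.image_union, Finset.coe_image, ← Set.range_comp',
    Set.union_assoc, Set.union_comm]

theorem IsQuad.quadLabel_mod_four (h : IsQuad L p s t) :
    ∀ n ∈ Set.range (quadLabel p s t), n % 4 = 1 ∨ n % 4 = 3 := by
  have := h.corner_pos
  intro n hn
  rw [mem_range_quadLabel] at hn
  omega

theorem IsQuad.four_mul_mem_iff (h : IsQuad L p s t) :
    4 * m ∈ (4 * ·) '' L ∪ Set.range (quadLabel p s t) ↔ m ∈ L := by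
  rw [Set.mem_union, or_iff_left, Function.Injective.mem_set_image]
  · exact mul_right_injective₀ four_ne_zero
  · intro hm
    have := h.quadLabel_mod_four _ hm
    omega

theorem IsQuad.four_mul_add_notMem (h : IsQuad L p s t) (hm : m ∈ L) (hm₀ : 0 < m)
    (hn : n ∈ Set.range (quadLabel p s t)) :
    4 * m + n ∉ (4 * ·) '' L ∪ Set.range (quadLabel p s t) := by
  have hp := h.corner_pos
  have hms : m ≠ s := fun hms => h.fst_notMem (hms ▸ hm)
  have hmt : m ≠ t := fun hmt => h.snd_notMem (hmt ▸ hm)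
  have hn₄ := h.quadLabel_mod_four n hn
  rintro (⟨k, -, hk⟩ | hk)
  · dsimp only at hk
    omega
  · rw [mem_range_quadLabel] at hn hk
    omega

theorem IsQuad.notMem_of_mod_four_eq_two (h : IsQuad L p s t) (hn : n % 4 = 2) :
    n ∉ (4 * ·) '' L ∪ Set.range (quadLabel p s t) := by
  rintro (⟨k, -, hk⟩ | hk)
  · dsimp only at hk
    omega
  · have := h.quadLabel_mod_four n hk
    omega

theorem IsQuad.quadLabel_injective (h : IsQuad L p s t) :
    Function.Injective (quadLabel p s t) := by
  have := h.corner_pos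
  have := h.fst_pos
  have := h.snd_pos
  intro i j hij
  fin_cases i <;> fin_cases j <;> simp [quadLabel] at hij ⊢ <;> omega

theorem adj_cycleGraph_four_iff {c : Fin 4 → ℕ} {S : Set ℕ} (h₀₁ : c 0 + c 1 ∈ S)
    (h₁₂ : c 1 + c 2 ∈ S) (h₂₃ : c 2 + c 3 ∈ S) (h₀₃ : c 0 + c 3 ∈ S) (h₀₂ : c 0 + c 2 ∉ S)
    (h₁₃ : c 1 + c 3 ∉ S) :
    ∀ i j, (cycleGraph 4).Adj i j ↔ i ≠ j ∧ c i + c j ∈ S := by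
  refine adj_iff_of_lt fun i j hij => ?_
  rw [cycleGraph_adj_of_lt hij]
  fin_cases i <;> fin_cases j <;> simp_all

theorem IsQuad.adj_cycleGraph_four_iff (h : IsQuad L p s t) (i j : Fin 4) :
    (cycleGraph 4).Adj i j ↔ i ≠ j ∧
      quadLabel p s t i + quadLabel p s t j ∈ (4 * ·) '' L ∪ Set.range (quadLabel p s t) := by
  have := h.corner_pos
  refine SumGraph.adj_cycleGraph_four_iff (Or.inl ⟨_, h.corner_mem, ?_⟩)
    (Or.inl ⟨_, h.add_snd_mem, ?_⟩) (Or.inl ⟨_, h.add_add_mem, ?_⟩)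
    (Or.inl ⟨_, h.add_fst_mem, ?_⟩) (h.notMem_of_mod_four_eq_two ?_)
    (h.notMem_of_mod_four_eq_two ?_) i j <;> simp [quadLabel] <;> omega

theorem SumLabellingWith.cycleGraph_four_sum (h : SumLabellingWith G l P)
    (hq : IsQuad (labels l P) p s t) :
    SumLabellingWith (cycleGraph 4 ⊕g G) (Sum.elim (quadLabel p s t) fun v => 4 * l v)
      (P.image (4 * ·)) := by
  have mixed {m} (hm : m ∈ labels l P) (i) := hq.four_mul_add_notMem hm (h.pos m hm) ⟨i, rfl⟩
  have mod_four (i) := hq.quadLabel_mod_four _ ⟨i, rfl⟩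
  have four_mul_injective : Function.Injective (4 * · : ℕ → ℕ) :=
    mul_right_injective₀ four_ne_zero
  refine ⟨?_, ?_, ?_, ?_, ?_⟩
  · refine hq.quadLabel_injective.sumElim (four_mul_injective.comp h.injective) fun i v hiv => ?_
    have := mod_four i
    omega
  · rw [labels_quadLabel]
    rintro _ (⟨m, hm, rfl⟩ | ⟨i, rfl⟩)
    · exact Nat.mul_pos four_pos (h.pos m hm)
    · have := mod_four i
      omega
  · rintro (i | v)
    · have := mod_four i
      simp only [Sum.elim_inl, Finset.mem_image, not_exists, not_and]
      omega
    · simpa [four_mul_injective.mem_finset_image] using h.notMem v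
  · rw [labels_quadLabel]
    rintro (i | x) (j | y)
    · simpa only [sum_adj_inl, Sum.elim_inl, Sum.inl_injective.ne_iff] using
        hq.adj_cycleGraph_four_iff i j
    · simpa [add_comm] using mixed (apply_mem_labels y) i
    · simpa using mixed (apply_mem_labels x) j
    · rw [sum_adj_inr, Sum.elim_inr, Sum.elim_inr, ← mul_add, hq.four_mul_mem_iff, h.adj_iff,
        Sum.inr_injective.ne_iff]
  · simp only [labels_quadLabel, Finset.forall_mem_image]
    rintro _ (⟨m, hm, rfl⟩ | ⟨i, rfl⟩) q hqP hne
    · dsimp only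
      rw [← mul_add, hq.four_mul_mem_iff]
      exact h.add_notMem m hm q hqP (mt (congrArg _) hne)
    · rw [add_comm]
      exact mixed (mem_labels_of_mem hqP) i

theorem CappedLabelling.cycleGraph_four_sum (h : CappedLabelling G l A B)
    (hq : IsQuad (labels l {A, B}) p s t) :
    CappedLabelling (cycleGraph 4 ⊕g G) (Sum.elim (quadLabel p s t) fun v => 4 * l v)
      (4 * A) (4 * B) where
  toSumLabellingWith := by
    simpa only [Finset.image_insert, Finset.image_singleton] using h.1.cycleGraph_four_sum hq
  lt := by
    have := h.cap_lt
    have := hq.corner_pos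
    have := hq.fst_pos
    have := hq.snd_pos
    have := h.le_of_mem_labels hq.add_fst_mem
    have := h.le_of_mem_labels hq.add_snd_mem
    have := h.le_of_mem_labels hq.add_add_mem
    rintro (i | v)
    · have hi := mem_range_quadLabel.1 (Set.mem_range_self (f := quadLabel p s t) i)
      rw [Sum.elim_inl]
      omega
    · exact Nat.mul_lt_mul_of_pos_left (h.lt v) four_pos
  cap_lt := Nat.mul_lt_mul_of_pos_left h.cap_lt four_pos
  cap_ne := by
    have := h.cap_ne
    omega

theorem IsQuad.four_mul (h : IsQuad L p s t) :
    IsQuad ((4 * ·) '' L ∪ Set.range (quadLabel p s t)) (4 * p) (4 * s) (4 * t) := by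
  have := h.fst_pos
  have := h.snd_pos
  refine ⟨by omega, by omega, ?_, ?_, ?_, ?_, ?_, ?_⟩ <;>
    simp only [← mul_add, h.four_mul_mem_iff]
  exacts [h.corner_mem, h.add_fst_mem, h.add_snd_mem, h.add_add_mem, h.fst_notMem, h.snd_notMem]

end Quad

section QuadLabelling

variable {V W : Type*} {G : SimpleGraph V} {H : SimpleGraph W} {l : V → ℕ} {A B m n p s t : ℕ}

theorem CappedLabelling.comp_iso (h : CappedLabelling G l A B) (e : H ≃g G) :
    CappedLabelling H (l ∘ e) A B where
  toSumLabellingWith := h.1.comp_iso e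
  lt w := h.lt (e w)
  cap_lt := h.cap_lt
  cap_ne := h.cap_ne

theorem CappedLabelling.snd_pos (h : CappedLabelling G l A B) : 0 < B :=
  h.pos B (mem_labels_of_mem (by simp))

theorem CappedLabelling.pathGraph_sum (h : CappedLabelling G l A B) (hn : 1 ≤ n) :
    SumLabellingWith (pathGraph n ⊕g G) (Sum.elim (fun i => gib A B i) l) {gib A B n} :=
  h.glue (sumLabellingWith_pathGraph h.snd_pos h.cap_lt n)
    (by rw [labels_gib]; exact isGluable_gib h.snd_pos h.cap_lt hn)

/-- `G` has a sum labelling with two isolates to which arbitrary paths and cycles, including cycles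
of length `4`, can be added without changing the number of isolates. -/
def HasQuadLabelling (G : SimpleGraph V) : Prop :=
  ∃ l A B, CappedLabelling G l A B ∧ ∃ p s t, IsQuad (labels l {A, B}) p s t

namespace HasQuadLabelling

theorem of_singleton (h : SumLabellingWith G l {A}) (hl : ∀ v, l v < A)
    (hq : IsQuad (labels l {A}) p s t) : HasQuadLabelling G := by
  refine ⟨l, 4 * A, A, .of_singleton h hl, p, s, t, ?_⟩
  rw [labels_pair]
  refine hq.mono (Set.subset_insert _ _) ?_
  rintro n (rfl | hn) hn' m hm
  · rcases hm with ⟨v, rfl⟩ | hm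
    · have := hl v
      omega
    · rw [Finset.coe_singleton, Set.mem_singleton_iff] at hm
      omega
  · exact absurd hn hn'

theorem comp_iso (h : HasQuadLabelling G) (e : H ≃g G) : HasQuadLabelling H := by
  obtain ⟨l, A, B, hl, p, s, t, hq⟩ := h
  exact ⟨l ∘ e, A, B, hl.comp_iso e, p, s, t, labels_comp_equiv (l := l) e.toEquiv ▸ hq⟩

theorem sumNumber_le (h : HasQuadLabelling G) : G.sumNumber ≤ 2 := by
  obtain ⟨l, A, B, hl, -⟩ := h
  exact hl.sumNumber_le.trans Finset.card_le_two

theorem pathGraph_sum (h : HasQuadLabelling G) (hn : 2 ≤ n) :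
    HasQuadLabelling (pathGraph n ⊕g G) := by
  obtain ⟨l, A, B, hl, p, s, t, hq⟩ := h
  have hn₁ : 1 ≤ n := by omega
  have hgib := isGluable_gib hl.snd_pos hl.cap_lt hn₁
  refine of_singleton (hl.pathGraph_sum hn₁) ?_ (hl.isQuad_glue (labels_gib A B n ▸ hgib) hq)
  rintro (i | v)
  · exact gib_lt_gib hl.snd_pos hl.cap_lt hn i.2
  · exact (hl.lt v).trans_le (le_gib hl.cap_lt n)

theorem cycleGraph_sum_of_ne_one (h : HasQuadLabelling G) (hm : m ≠ 1) :
    HasQuadLabelling (cycleGraph (m + 3) ⊕g G) := by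
  obtain ⟨l, A, B, hl, p, s, t, hq⟩ := h
  obtain ⟨C, D, hCD, labels_eq⟩ :=
    exists_cappedLabelling_cycleGraph hl.snd_pos hl.cap_lt hl.cap_ne hm
  have hS := labels_eq ▸ isGluable_insert_gib hl.snd_pos hl.cap_lt m
  exact ⟨_, C, D, hl.glue_capped hCD hS, p, s, t, hl.isQuad_glue hS hq⟩

theorem cycleGraph_four_sum (h : HasQuadLabelling G) :
    HasQuadLabelling (cycleGraph 4 ⊕g G) := by
  obtain ⟨l, A, B, hl, p, s, t, hq⟩ := h
  refine ⟨_, _, _, hl.cycleGraph_four_sum hq, 4 * p, 4 * s, 4 * t, ?_⟩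
  have := labels_quadLabel (l := l) (P := {A, B}) (p := p) (s := s) (t := t)
  rw [Finset.image_insert, Finset.image_singleton] at this
  exact this ▸ hq.four_mul

theorem cycleGraph_sum (h : HasQuadLabelling G) (m : ℕ) :
    HasQuadLabelling (cycleGraph (m + 3) ⊕g G) := by
  by_cases hm : m = 1
  · exact hm ▸ h.cycleGraph_four_sum
  · exact h.cycleGraph_sum_of_ne_one hm

end HasQuadLabelling

theorem hasQuadLabelling_pathGraph_of_three_le (hn : 3 ≤ n) : HasQuadLabelling (pathGraph n) := by
  refine .of_singleton (sumLabellingWith_pathGraph (A := 3) (B := 1) one_pos (by norm_num) n)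
    (fun i => gib_lt_gib one_pos (by norm_num) (by omega) i.2) (p := 1) (s := 2) (t := 2) ?_
  rw [labels_gib]
  exact (isGluable_gib one_pos (by norm_num) (by omega)).isQuad ⟨3, hn, rfl⟩

theorem hasQuadLabelling_cycleGraph (hm : m ≠ 1) : HasQuadLabelling (cycleGraph (m + 3)) := by
  obtain ⟨C, D, hCD, labels_eq⟩ :=
    exists_cappedLabelling_cycleGraph (A := 3) (B := 1) one_pos (by norm_num) (by norm_num) hm
  refine ⟨_, C, D, hCD, 1, 2, 2, ?_⟩
  rw [labels_eq]
  exact (isGluable_insert_gib one_pos (by norm_num) m).isQuad (Or.inr ⟨3, by simp, rfl⟩)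

theorem labels_eq_coe [Fintype V] (l : V → ℕ) (P : Finset ℕ) :
    labels l P = ↑(Finset.univ.image l ∪ P) := by
  rw [labels, Finset.coe_union, Finset.coe_image, Finset.coe_univ, Set.image_univ]

theorem sumLabellingWith_cycleGraph_four :
    SumLabellingWith (cycleGraph 4) ![1, 3, 10, 12] {4, 13, 22} := by
  constructor <;> (try simp only [labels_eq_coe, Finset.mem_coe]) <;> decide

theorem hasQuadLabelling_pathGraph_two : HasQuadLabelling (pathGraph 2) := by
  refine ⟨![1, 4], 7, 5,
    ⟨⟨?_, ?_, ?_, ?_, ?_⟩, ?_, ?_, ?_⟩, 1, 3, 3, ?_, ?_, ?_, ?_, ?_, ?_, ?_, ?_⟩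
  all_goals try simp only [labels_eq_coe, Finset.mem_coe, pathGraph_adj]
  all_goals decide

theorem hasQuadLabelling_cycleGraph_four_sum_self :
    HasQuadLabelling (cycleGraph 4 ⊕g cycleGraph 4) := by
  refine ⟨Sum.elim ![16, 12, 7, 3] ![10, 6, 1, 2], 28, 19,
    ⟨⟨?_, ?_, ?_, ?_, ?_⟩, ?_, ?_, ?_⟩, 10, 9, 9, ?_, ?_, ?_, ?_, ?_, ?_, ?_, ?_⟩
  all_goals try simp only [labels_eq_coe, Finset.mem_coe, Sum.forall, sum_adj]
  all_goals decide

end QuadLabelling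

section Components

variable {V W : Type*} {G : SimpleGraph V} {H : SimpleGraph W} {n : ℕ}

theorem exists_iso_sum_induce_of_copy [Finite V] (f : Copy H G)
    (hf : ∀ i, (G.neighborSet (f i)).ncard ≤ (H.neighborSet i).ncard) :
    Nonempty (G ≃g H ⊕g G.induce (Set.range f)ᶜ) := by
  classical
  have image_eq (i) : f '' H.neighborSet i = G.neighborSet (f i) := by
    refine Set.eq_of_subset_of_ncard_le ?_ ?_
    · rintro _ ⟨j, hij, rfl⟩
      exact f.toHom.map_adj hij
    · rw [Set.ncard_image_of_injective (f := f) _ f.injective]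
      exact hf i
  have adj_iff {i v} : G.Adj (f i) v ↔ ∃ j, H.Adj i j ∧ f j = v :=
    (Set.ext_iff.1 (image_eq i) v).symm
  have not_adj (i) (v : ((Set.range f)ᶜ : Set V)) : ¬ G.Adj (f i) v := fun h => by
    obtain ⟨j, -, hj⟩ := adj_iff.1 h
    exact v.2 ⟨j, hj⟩
  let e : W ⊕ ((Set.range f)ᶜ : Set V) ≃ V :=
    ((Equiv.ofInjective f f.injective).sumCongr (.refl _)).trans (Equiv.Set.sumCompl (Set.range f))
  refine ⟨Iso.symm ⟨e, ?_⟩⟩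
  rintro (i | v) (j | w)
  · change G.Adj (f i) (f j) ↔ _
    rw [sum_adj_inl, adj_iff]
    exact ⟨fun ⟨k, hk, hkj⟩ => f.injective hkj ▸ hk, fun h => ⟨j, h, rfl⟩⟩
  · change G.Adj (f i) w ↔ _
    simp [not_adj]
  · change G.Adj v (f j) ↔ _
    simp [G.adj_comm v, not_adj]
  · change G.Adj v w ↔ _
    rw [sum_adj_inr, comap_adj]
    rfl

theorem ncard_neighborSet_eq_degree (G : SimpleGraph V) (v : V) [Fintype (G.neighborSet v)] :
    (G.neighborSet v).ncard = G.degree v := by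
  rw [Set.ncard_eq_toFinset_card', Set.toFinset_card, card_neighborSet_eq_degree]

theorem ncard_neighborSet_apply_iso (e : G ≃g H) (v : V) :
    (H.neighborSet (e v)).ncard = (G.neighborSet v).ncard :=
  (Set.ncard_congr' (e.mapNeighborSet v)).symm

theorem ncard_neighborSet_of_iso_sum {U : Type*} {K : SimpleGraph U} (e : G ≃g H ⊕g K) (u : U) :
    (G.neighborSet (e.symm (Sum.inr u))).ncard = (K.neighborSet u).ncard := by
  rw [ncard_neighborSet_apply_iso, neighborSet_sum_inr,
    Set.ncard_image_of_injective _ Sum.inr_injective]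

theorem ncard_neighborSet_cycleGraph (n : ℕ) (v : Fin (n + 3)) :
    ((cycleGraph (n + 3)).neighborSet v).ncard = 2 := by
  rw [ncard_neighborSet_eq_degree, cycleGraph_degree_three_le]

theorem exists_isPath_forall_adj_mem_support [Finite V] (G : SimpleGraph V) (x : V) :
    ∃ y, ∃ p : G.Walk x y, p.IsPath ∧ ∀ z, G.Adj y z → z ∈ p.support := by
  classical
  have := Fintype.ofFinite V
  have : DecidableRel G.Adj := Classical.decRel _
  have : Nonempty (Σ y, G.Path x y) := ⟨⟨x, .nil⟩⟩
  obtain ⟨⟨y, p⟩, hmax⟩ := Finite.exists_max fun p : Σ y, G.Path x y => p.2.1.length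
  refine ⟨y, p, p.2, fun z hz => ?_⟩
  by_contra hzp
  have hle : (p.1.concat hz).length ≤ p.1.length := hmax ⟨z, _, p.2.concat hzp hz⟩
  rw [Walk.length_concat] at hle
  omega

theorem not_isAcyclic_of_two_le_ncard_neighborSet [Finite V] [Nonempty V]
    (h : ∀ v, 2 ≤ (G.neighborSet v).ncard) : ¬ G.IsAcyclic := by
  intro hG
  obtain ⟨x⟩ := ‹Nonempty V›
  obtain ⟨y, p, hp, hmem⟩ := exists_isPath_forall_adj_mem_support G x
  have eq_penultimate {z} (hz : G.Adj y z) : z = p.penultimate :=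
    hG.eq_penultimate_of_adj_end hp hz (hmem z hz)
  have : (G.neighborSet y).ncard ≤ 1 :=
    (Set.ncard_le_ncard (fun _ => eq_penultimate)).trans_eq (Set.ncard_singleton _)
  have := h y
  omega

theorem exists_iso_cycleGraph_sum [Finite V] [Nonempty V]
    (h : ∀ v, (G.neighborSet v).ncard = 2) :
    ∃ n, ∃ s : Set V, Nonempty (G ≃g cycleGraph (n + 3) ⊕g G.induce s) := by
  have hG := not_isAcyclic_of_two_le_ncard_neighborSet fun v => (h v).ge
  rw [isAcyclic_iff_free_cycleGraph] at hG
  push Not at hG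
  obtain ⟨n, hn, ⟨f⟩⟩ := hG
  obtain ⟨n, rfl⟩ := Nat.exists_eq_add_of_le' hn
  exact ⟨n, _, exists_iso_sum_induce_of_copy f fun i => by
    rw [h, ncard_neighborSet_cycleGraph]⟩

theorem eq_penultimate_of_adj_end [Finite V] {x y z : V} {p : G.Walk x y} (hp : p.IsPath)
    (hx : (G.neighborSet x).ncard ≤ 1) (h : ∀ v, (G.neighborSet v).ncard ≤ 2)
    (hz : G.Adj y z) (hzp : z ∈ p.support) : z = p.penultimate := by
  obtain ⟨i, rfl, hi⟩ := Walk.mem_support_iff_exists_getVert.1 hzp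
  have getVert_ne {i} (hi : i < p.length) : p.getVert i ≠ y := fun h =>
    hi.ne ((hp.getVert_eq_end_iff hi.le).1 h)
  have hi_ne : i ≠ p.length := by
    rintro rfl
    exact hz.ne p.getVert_length.symm
  by_contra hne
  have hi_lt : i + 1 < p.length := by
    have : i ≠ p.length - 1 := fun h => hne (congrArg p.getVert h)
    omega
  have hsucc : G.Adj (p.getVert i) (p.getVert (i + 1)) := p.adj_getVert_succ (by omega)
  rcases i with _ | i
  · rw [Walk.getVert_zero] at hz hsucc
    exact getVert_ne hi_lt ((Set.ncard_le_one (Set.toFinite _)).1 hx _ hsucc _ hz.symm)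
  · have hpred : G.Adj (p.getVert (i + 1)) (p.getVert i) := (p.adj_getVert_succ (by omega)).symm
    have hne' : p.getVert i ≠ p.getVert (i + 2) := fun h => by
      have := hp.getVert_injOn (by simp; omega) (by simp; omega) h
      omega
    have : 2 < (G.neighborSet (p.getVert (i + 1))).ncard := (Set.two_lt_ncard (Set.toFinite _)).2
      ⟨_, hpred, _, hsucc, _, hz.symm, hne', getVert_ne (by omega), getVert_ne hi_lt⟩
    exact this.not_ge (h _)

theorem exists_isPath_forall_adj_eq_penultimate [Finite V] {x : V}
    (hx : (G.neighborSet x).ncard ≤ 1) (h : ∀ v, (G.neighborSet v).ncard ≤ 2) :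
    ∃ y, ∃ p : G.Walk x y, p.IsPath ∧ ∀ z, G.Adj y z → z = p.penultimate := by
  obtain ⟨y, p, hp, hmem⟩ := exists_isPath_forall_adj_mem_support G x
  exact ⟨y, p, hp, fun z hz => eq_penultimate_of_adj_end hp hx h hz (hmem z hz)⟩

theorem one_le_ncard_neighborSet_pathGraph (hn : 2 ≤ n) (i : Fin n) :
    1 ≤ ((pathGraph n).neighborSet i).ncard := by
  refine (Set.ncard_pos (Set.toFinite _)).2 ?_
  by_cases hi : (i : ℕ) = 0
  · exact ⟨⟨1, hn⟩, pathGraph_adj.2 (Or.inl (by simp [hi]))⟩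
  · exact ⟨⟨i - 1, by omega⟩, pathGraph_adj.2 (Or.inr (Nat.sub_one_add_one hi))⟩

theorem two_le_ncard_neighborSet_pathGraph {i : Fin n} (hi : 0 < (i : ℕ)) (hin : i + 1 < n) :
    2 ≤ ((pathGraph n).neighborSet i).ncard :=
  (Set.one_lt_ncard (Set.toFinite _)).2
    ⟨⟨i - 1, by omega⟩, pathGraph_adj.2 (Or.inr (Nat.sub_one_add_one hi.ne')),
      ⟨i + 1, hin⟩, pathGraph_adj.2 (Or.inl rfl), by simp⟩

theorem exists_iso_pathGraph_sum [Finite V] {x : V} (hx : (G.neighborSet x).ncard = 1)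
    (h : ∀ v, (G.neighborSet v).ncard ≤ 2) :
    ∃ n ≥ 2, ∃ s : Set V, Nonempty (G ≃g pathGraph n ⊕g G.induce s) := by
  classical
  obtain ⟨y, p, hp, eq_penultimate⟩ := exists_isPath_forall_adj_eq_penultimate hx.le h
  have hp_length : p.length ≠ 0 := fun hp0 => by
    obtain rfl := Walk.eq_of_length_eq_zero hp0
    obtain ⟨z, hz⟩ := Set.nonempty_of_ncard_ne_zero (hx.trans_ne one_ne_zero)
    refine hz.ne ((eq_penultimate z hz).trans ?_).symm
    exact p.getVert_of_length_le (by omega)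
  refine ⟨p.length + 1, by omega, _, exists_iso_sum_induce_of_copy hp.pathGraphCopy fun i => ?_⟩
  have apply_eq : hp.pathGraphCopy i = p.getVert i :=
    p.support_getElem_eq_getVert _
  rcases Nat.eq_zero_or_pos i with hi | hi
  · rw [apply_eq, hi, Walk.getVert_zero, hx]
    exact one_le_ncard_neighborSet_pathGraph (by omega) i
  · rcases (Nat.le_of_lt_succ i.2).eq_or_lt with hin | hin
    · rw [apply_eq, hin, Walk.getVert_length]
      have : (G.neighborSet y).ncard ≤ 1 :=
        (Set.ncard_le_ncard eq_penultimate).trans_eq (Set.ncard_singleton _)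
      exact this.trans (one_le_ncard_neighborSet_pathGraph (by omega) i)
    · exact (h _).trans (two_le_ncard_neighborSet_pathGraph hi (by omega))

end Components

section UpperBounds

variable {V W : Type*} {G : SimpleGraph V} {H : SimpleGraph W} {m n : ℕ}

theorem nonempty_sum_iso_of_isEmpty (G : SimpleGraph V) (H : SimpleGraph W) [IsEmpty W] :
    Nonempty (G ⊕g H ≃g G) :=
  ⟨Equiv.sumEmpty V W, by simp⟩

theorem hasQuadLabelling_pathGraph (hn : 2 ≤ n) : HasQuadLabelling (pathGraph n) := by
  rcases hn.eq_or_lt with rfl | hn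
  · exact hasQuadLabelling_pathGraph_two
  · exact hasQuadLabelling_pathGraph_of_three_le hn

theorem HasQuadLabelling.of_iso_pathGraph_sum (e : G ≃g pathGraph n ⊕g H) (hn : 2 ≤ n)
    (hH : IsEmpty W ∨ Nonempty (H ≃g cycleGraph 4) ∨ HasQuadLabelling H) : HasQuadLabelling G := by
  obtain hW | ⟨⟨f⟩⟩ | hH := hH
  · obtain ⟨f⟩ := nonempty_sum_iso_of_isEmpty (pathGraph n) H
    exact (hasQuadLabelling_pathGraph hn).comp_iso (e.trans f)
  · exact (hasQuadLabelling_pathGraph hn).cycleGraph_four_sum.comp_iso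
      (e.trans ((Iso.sumCongr .refl f).trans Iso.sumComm))
  · exact (hH.pathGraph_sum hn).comp_iso e

theorem nonempty_iso_or_hasQuadLabelling_of_iso_cycleGraph_sum (e : G ≃g cycleGraph (m + 3) ⊕g H)
    (hH : IsEmpty W ∨ Nonempty (H ≃g cycleGraph 4) ∨ HasQuadLabelling H) :
    Nonempty (G ≃g cycleGraph 4) ∨ HasQuadLabelling G := by
  obtain hW | ⟨⟨f⟩⟩ | hH := hH
  · obtain ⟨f⟩ := nonempty_sum_iso_of_isEmpty (cycleGraph (m + 3)) H
    rcases eq_or_ne m 1 with rfl | hm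
    · exact .inl ⟨e.trans f⟩
    · exact .inr ((hasQuadLabelling_cycleGraph hm).comp_iso (e.trans f))
  · refine .inr (.comp_iso ?_ (e.trans (Iso.sumCongr .refl f)))
    rcases eq_or_ne m 1 with rfl | hm
    · exact hasQuadLabelling_cycleGraph_four_sum_self
    · exact (hasQuadLabelling_cycleGraph hm).cycleGraph_four_sum.comp_iso Iso.sumComm
  · exact .inr ((hH.cycleGraph_sum m).comp_iso e)

theorem isEmpty_or_iso_cycleGraph_four_or_hasQuadLabelling [Finite V]
    (h : ∀ v, (G.neighborSet v).ncard ∈ Set.Icc 1 2) :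
    IsEmpty V ∨ Nonempty (G ≃g cycleGraph 4) ∨ HasQuadLabelling G := by
  induction hk : Nat.card V using Nat.strong_induction_on generalizing V with
  | _ k ih =>
  subst hk
  have ih' {n s} {K : SimpleGraph (Fin n)} (hn : 0 < n) (e : G ≃g K ⊕g G.induce s) :
      IsEmpty s ∨ Nonempty (G.induce s ≃g cycleGraph 4) ∨ HasQuadLabelling (G.induce s) := by
    refine ih (Nat.card s) ?_ (fun v => ?_) rfl
    · rw [Nat.card_congr e.toEquiv, Nat.card_sum, Nat.card_fin]
      omega
    · exact ncard_neighborSet_of_iso_sum e v ▸ h _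
  rcases isEmpty_or_nonempty V with hV | hV
  · exact .inl hV
  right
  by_cases hx : ∃ x, (G.neighborSet x).ncard = 1
  · obtain ⟨x, hx⟩ := hx
    obtain ⟨n, hn, s, ⟨e⟩⟩ := exists_iso_pathGraph_sum hx fun v => (h v).2
    exact .inr (.of_iso_pathGraph_sum e hn (ih' (by omega) e))
  · push Not at hx
    obtain ⟨m, s, ⟨e⟩⟩ := exists_iso_cycleGraph_sum fun v =>
      (h v).2.antisymm (Nat.succ_le_of_lt ((h v).1.lt_of_ne' (hx v)))
    exact nonempty_iso_or_hasQuadLabelling_of_iso_cycleGraph_sum e (ih' (by omega) e)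

theorem sumNumber_le_two [Finite V] (h : ∀ v, (G.neighborSet v).ncard ∈ Set.Icc 1 2)
    (hG : ¬ Nonempty (G ≃g cycleGraph 4)) : G.sumNumber ≤ 2 := by
  rcases isEmpty_or_iso_cycleGraph_four_or_hasQuadLabelling h with hV | hG' | hG'
  · exact (CappedLabelling.of_isEmpty G fun _ => 0).sumNumber_le.trans Finset.card_le_two
  · exact absurd hG' hG
  · exact hG'.sumNumber_le

theorem exists_sumLabellingWith_singleton_pathGraph_sum_cycleGraph_four (hn : 3 ≤ n) :
    ∃ l A, SumLabellingWith (pathGraph n ⊕g cycleGraph 4) l {A} := by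
  have hG := sumLabellingWith_pathGraph (A := 3) (B := 1) one_pos (by norm_num) n
  have hq : IsQuad (labels (gib 3 1 · : Fin n → ℕ) {gib 3 1 n}) 1 2 2 := by
    rw [labels_gib]
    exact (isGluable_gib one_pos (by norm_num) (by omega)).isQuad ⟨3, hn, rfl⟩
  exact ⟨_, _, (hG.cycleGraph_four_sum hq).comp_iso Iso.sumComm⟩

theorem sumNumber_le_one [Finite V] (h : ∀ v, (G.neighborSet v).ncard ∈ Set.Icc 1 2)
    {x : V} (hx : (G.neighborSet x).ncard = 1)
    (hG : ¬ Nonempty (G ≃g cycleGraph 4 ⊕g pathGraph 2)) : G.sumNumber ≤ 1 := by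
  obtain ⟨n, hn, s, ⟨e⟩⟩ := exists_iso_pathGraph_sum hx fun v => (h v).2
  suffices ∃ l A, SumLabellingWith (pathGraph n ⊕g G.induce s) l {A} by
    obtain ⟨l, A, hl⟩ := this
    exact (hl.comp_iso e).sumNumber_le
  rcases isEmpty_or_iso_cycleGraph_four_or_hasQuadLabelling
    fun v => ncard_neighborSet_of_iso_sum e v ▸ h _ with hs | ⟨⟨f⟩⟩ | ⟨l, A, B, hl, -⟩
  · exact ⟨_, _, (CappedLabelling.of_isEmpty _ fun _ => 0).pathGraph_sum (by omega)⟩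
  · have hn2 : n ≠ 2 := by
      rintro rfl
      exact hG ⟨e.trans ((Iso.sumCongr .refl f).trans Iso.sumComm)⟩
    obtain ⟨l, A, hl⟩ :=
      exists_sumLabellingWith_singleton_pathGraph_sum_cycleGraph_four (n := n) (by omega)
    exact ⟨_, _, hl.comp_iso (Iso.sumCongr .refl f)⟩
  · exact ⟨_, _, hl.pathGraph_sum (by omega)⟩

end UpperBounds

section LowerBounds

variable {V W : Type*} {G : SimpleGraph V} {K : SimpleGraph W} {k : ℕ}

theorem isSumGraph_addIsolates_sumNumber [Finite V] (G : SimpleGraph V) :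
    (G.addIsolates G.sumNumber).IsSumGraph :=
  Nat.sInf_mem G.exists_isSumGraph_addIsolates

theorem minDegree_le_of_isSumGraph_addIsolates [Fintype V] [DecidableRel G.Adj]
    (h : (G.addIsolates k).IsSumGraph) : G.minDegree ≤ k := by
  obtain ⟨l, hinj, hpos, hadj⟩ := h
  rcases isEmpty_or_nonempty V with hV | hV
  · rw [minDegree_of_subsingleton]
    exact Nat.zero_le k
  obtain ⟨x, hx⟩ := Finite.exists_max fun v => l (Sum.inl v)
  have exists_isolate (y : G.neighborSet x) :
      ∃ i : Fin k, l (Sum.inr i) = l (Sum.inl x) + l (Sum.inl y.1) := by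
    obtain ⟨-, z | i, hz⟩ := (hadj (Sum.inl x) (Sum.inl y.1)).1 (sum_adj_inl.2 y.2)
    · have := hx z
      have := hpos (Sum.inl y.1)
      omega
    · exact ⟨i, hz⟩
  choose f hf using exists_isolate
  have hf_inj : Function.Injective f := fun y y' h => by
    have := hf y
    rw [h, hf y', Nat.add_left_cancel_iff] at this
    exact Subtype.ext (Sum.inl_injective (hinj this.symm))
  calc G.minDegree ≤ G.degree x := G.minDegree_le_degree x
    _ = Fintype.card (G.neighborSet x) := (G.card_neighborSet_eq_degree x).symm
    _ ≤ Fintype.card (Fin k) := Fintype.card_le_of_injective f hf_inj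
    _ = k := Fintype.card_fin k

theorem isSumLabelling_comp_iso {l : W → ℕ} (h : K.IsSumLabelling l) (e : G ≃g K) :
    G.IsSumLabelling (l ∘ e) := by
  obtain ⟨hinj, hpos, hadj⟩ := h
  refine ⟨hinj.comp e.injective, fun v => hpos _, fun x y => ?_⟩
  rw [← e.map_adj_iff, hadj, e.injective.ne_iff, e.surjective.exists]
  rfl

theorem exists_iso_cycleGraph_four_forall_le (f : Fin 4 → ℕ) (hf : Function.Injective f) :
    ∃ e : cycleGraph 4 ≃g cycleGraph 4, (∀ i, f (e i) ≤ f (e 3)) ∧ f (e 2) < f (e 0) := by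
  have exists_rotation (i : Fin 4) : ∃ e : cycleGraph 4 ≃g cycleGraph 4, e 3 = i :=
    ⟨⟨.addLeft (i + 1), by revert i; decide⟩, by revert i; decide⟩
  let reflection : cycleGraph 4 ≃g cycleGraph 4 := ⟨.subLeft 2, by decide⟩
  obtain ⟨i, hi⟩ := Finite.exists_max f
  obtain ⟨e, rfl⟩ := exists_rotation i
  rcases lt_or_gt_of_ne (hf.ne (e.injective.ne (show (2 : Fin 4) ≠ 0 by decide))) with h | h
  · exact ⟨e, fun j => hi (e j), h⟩
  · exact ⟨reflection.trans e, fun j => hi (e (reflection j)), h⟩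

section FourCycle

variable {l : Fin 4 ⊕ W → ℕ}

theorem ne_add_of_isSumLabelling_sum {l : V ⊕ W → ℕ} (h : (G ⊕g K).IsSumLabelling l) (v : V)
    (w : W) (z : V ⊕ W) : l z ≠ l (Sum.inl v) + l (Sum.inr w) := fun hz => by
  simpa using (h.2.2 (Sum.inl v) (Sum.inr w)).2 ⟨Sum.inl_ne_inr, z, hz⟩

/- If the sum on the edge `12` were the label of a vertex of the cycle, then regrouping it in the
sum on `30` would yield an edge between the cycle and `K`. -/
theorem exists_inr_eq_add_of_forall_le (h : (cycleGraph 4 ⊕g K).IsSumLabelling l)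
    (hmax : ∀ i, l (Sum.inl i) ≤ l (Sum.inl 3)) (hlt : l (Sum.inl 2) < l (Sum.inl 0)) :
    ∃ w₁ w₂ w₃, l (Sum.inr w₁) = l (Sum.inl 1) + l (Sum.inl 2) ∧
      l (Sum.inr w₂) = l (Sum.inl 2) + l (Sum.inl 3) ∧
      l (Sum.inr w₃) = l (Sum.inl 3) + l (Sum.inl 0) := by
  have exists_add {i j : Fin 4} (hij : (cycleGraph 4).Adj i j) :
      (∃ w, l (Sum.inr w) = l (Sum.inl i) + l (Sum.inl j)) ∨
        ∃ k, l (Sum.inl k) = l (Sum.inl i) + l (Sum.inl j) := by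
    obtain ⟨-, k | w, hz⟩ := (h.2.2 (Sum.inl i) (Sum.inl j)).1 (sum_adj_inl.2 hij)
    exacts [.inr ⟨k, hz⟩, .inl ⟨w, hz⟩]
  have exists_add_three {i : Fin 4} (hi : (cycleGraph 4).Adj 3 i) :
      ∃ w, l (Sum.inr w) = l (Sum.inl 3) + l (Sum.inl i) := by
    refine (exists_add hi).resolve_right fun ⟨k, hk⟩ => ?_
    have := hmax k
    have := h.2.1 (Sum.inl i)
    omega
  have not_adj := ne_add_of_isSumLabelling_sum h
  obtain ⟨w₂, hw₂⟩ := exists_add_three (i := 2) (by decide)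
  obtain ⟨w₃, hw₃⟩ := exists_add_three (i := 0) (by decide)
  rw [add_comm] at hw₂
  have hpos (i) := h.2.1 (Sum.inl i)
  rcases exists_add (i := 1) (j := 2) (by decide) with ⟨w₁, hw₁⟩ | ⟨k, hk⟩
  · exact ⟨w₁, w₂, w₃, hw₁, hw₂, hw₃⟩
  exfalso
  have hk_cases : k = 0 ∨ k = 3 := by
    fin_cases k
    · exact .inl rfl
    · exact absurd hk (by simpa using (hpos 2).ne')
    · exact absurd hk (by simpa using (hpos 1).ne')
    · exact .inr rfl
  rcases hk_cases with rfl | rfl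
  · exact not_adj 1 w₂ (Sum.inr w₃) (by omega)
  rcases exists_add (i := 0) (j := 1) (by decide) with ⟨w, hw⟩ | ⟨k, hk'⟩
  · exact not_adj 2 w (Sum.inr w₃) (by omega)
  · have := hpos 0
    have := hpos 1
    fin_cases k <;> simp only [Fin.zero_eta, Fin.mk_one, Fin.reduceFinMk] at hk' <;> omega

theorem exists_isSumLabelling_inr_lt (h : (cycleGraph 4 ⊕g K).IsSumGraph) :
    ∃ (l : Fin 4 ⊕ W → ℕ) (w₁ w₂ w₃ : W), (cycleGraph 4 ⊕g K).IsSumLabelling l ∧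
      (∀ i, l (Sum.inl i) ≤ l (Sum.inl 3)) ∧
      l (Sum.inr w₁) = l (Sum.inl 1) + l (Sum.inl 2) ∧
      l (Sum.inr w₂) = l (Sum.inl 2) + l (Sum.inl 3) ∧
      l (Sum.inr w₃) = l (Sum.inl 3) + l (Sum.inl 0) ∧
      l (Sum.inr w₁) < l (Sum.inr w₂) ∧ l (Sum.inr w₂) < l (Sum.inr w₃) := by
  obtain ⟨l, hl⟩ := h
  obtain ⟨e, hmax, hlt⟩ :=
    exists_iso_cycleGraph_four_forall_le (fun i => l (Sum.inl i)) (hl.1.comp Sum.inl_injective)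
  have hl' := isSumLabelling_comp_iso hl (Iso.sumCongr e (.refl (G := K)))
  obtain ⟨w₁, w₂, w₃, hw₁, hw₂, hw₃⟩ := exists_inr_eq_add_of_forall_le hl' hmax hlt
  refine ⟨_, w₁, w₂, w₃, hl', hmax, hw₁, hw₂, hw₃, ?_, ?_⟩
  · rw [hw₁, hw₂, add_comm, Nat.add_lt_add_iff_left]
    have one_ne_three : (1 : Fin 4) ≠ 3 := by decide
    exact (hmax 1).lt_of_ne (hl.1.ne (Sum.inl_injective.ne (e.injective.ne one_ne_three)))
  · rwa [hw₂, hw₃, add_comm, Nat.add_lt_add_iff_left]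

theorem three_le_card_of_isSumGraph_cycleGraph_four_sum [Fintype W]
    (h : (cycleGraph 4 ⊕g K).IsSumGraph) : 3 ≤ Fintype.card W := by
  obtain ⟨l, w₁, w₂, w₃, -, -, -, -, -, h₁₂, h₂₃⟩ := exists_isSumLabelling_inr_lt h
  have ne_of_lt {u v} (huv : l (Sum.inr u) < l (Sum.inr v)) : u ≠ v := fun h => huv.ne (h ▸ rfl)
  exact Fintype.two_lt_card_iff.2
    ⟨w₁, w₂, w₃, ne_of_lt h₁₂, ne_of_lt (h₁₂.trans h₂₃), ne_of_lt h₂₃⟩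

theorem four_le_card_of_isSumGraph_cycleGraph_four_sum [Fintype W] {u v : W} (huv : K.Adj u v)
    (h : (cycleGraph 4 ⊕g K).IsSumGraph) : 4 ≤ Fintype.card W := by
  classical
  obtain ⟨l, w₁, w₂, w₃, hl, hmax, hw₁, hw₂, hw₃, h₁₂, h₂₃⟩ := exists_isSumLabelling_inr_lt h
  have ne_of_lt {u v} (huv : l (Sum.inr u) < l (Sum.inr v)) : u ≠ v := fun h => huv.ne (h ▸ rfl)
  have card_eq : ({w₁, w₂, w₃} : Finset W).card = 3 := Finset.card_eq_three.2
    ⟨w₁, w₂, w₃, ne_of_lt h₁₂, ne_of_lt (h₁₂.trans h₂₃), ne_of_lt h₂₃, rfl⟩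
  by_contra! hcard
  have cover (w : W) : w = w₁ ∨ w = w₂ ∨ w = w₃ := by
    have eq_univ : ({w₁, w₂, w₃} : Finset W) = Finset.univ :=
      Finset.eq_univ_of_card _ (by have := Finset.card_le_univ {w₁, w₂, w₃}; omega)
    have hw : w ∈ ({w₁, w₂, w₃} : Finset W) := eq_univ ▸ Finset.mem_univ w
    simpa using hw
  have hpos := hl.2.1 (Sum.inl 1)
  obtain ⟨huv, z, hz⟩ := (hl.2.2 (Sum.inr u) (Sum.inr v)).1 (sum_adj_inr.2 huv)
  have add_eq : l (Sum.inr w₁) + l (Sum.inr w₂) = l (Sum.inr w₃) := by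
    rcases z with i | z
    · have := hmax i
      rcases cover u with rfl | rfl | rfl <;> rcases cover v with rfl | rfl | rfl <;>
        first | exact absurd rfl huv | omega
    · rcases cover u with rfl | rfl | rfl <;> rcases cover v with rfl | rfl | rfl <;>
        rcases cover z with rfl | rfl | rfl <;> first | exact absurd rfl huv | omega
  exact ne_add_of_isSumLabelling_sum hl 2 w₁ (Sum.inl 0) (by omega)

end FourCycle

section SumNumber

variable {G : SimpleGraph V}

theorem sumNumber_of_iso_cycleGraph_four [Finite V] (e : G ≃g cycleGraph 4) : G.sumNumber = 3 := by
  refine le_antisymm (sumLabellingWith_cycleGraph_four.comp_iso e).sumNumber_le ?_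
  obtain ⟨l, hl⟩ := isSumGraph_addIsolates_sumNumber G
  simpa using three_le_card_of_isSumGraph_cycleGraph_four_sum
    ⟨_, isSumLabelling_comp_iso hl (Iso.sumCongr e.symm .refl)⟩

theorem sumNumber_of_iso_cycleGraph_four_sum_pathGraph_two [Finite V]
    (e : G ≃g cycleGraph 4 ⊕g pathGraph 2) : G.sumNumber = 2 := by
  refine le_antisymm (hasQuadLabelling_pathGraph_two.cycleGraph_four_sum.comp_iso e).sumNumber_le ?_
  obtain ⟨l, hl⟩ := isSumGraph_addIsolates_sumNumber G
  have hcard := four_le_card_of_isSumGraph_cycleGraph_four_sum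
    (sum_adj_inl.2 (pathGraph_adj.2 (.inl rfl) : (pathGraph 2).Adj 0 1))
    ⟨_, isSumLabelling_comp_iso hl (Iso.sumAssoc.symm.trans (Iso.sumCongr e.symm .refl))⟩
  simp only [Fintype.card_sum, Fintype.card_fin] at hcard
  omega

theorem sumNumber_eq_zero_of_isEmpty [IsEmpty V] (G : SimpleGraph V) : G.sumNumber = 0 :=
  Nat.sInf_eq_zero.2 (.inl ⟨isEmptyElim, Function.injective_of_subsingleton _, isEmptyElim,
    isEmptyElim⟩)

end SumNumber

end LowerBounds

section MinDegree

variable {V : Type*} [Fintype V] {G : SimpleGraph V} [DecidableRel G.Adj]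

theorem ncard_neighborSet_mem_Icc (hmax : G.maxDegree ≤ 2) (hiso : ∀ v, ¬ G.IsIsolated v) (v : V) :
    (G.neighborSet v).ncard ∈ Set.Icc 1 2 := by
  rw [ncard_neighborSet_eq_degree]
  refine ⟨?_, (G.degree_le_maxDegree v).trans hmax⟩
  exact (G.degree_pos_iff_exists_adj v).2 (exists_adj_iff_not_isIsolated.2 (hiso v))

theorem le_minDegree_of_forall_le_ncard [Nonempty V] {k : ℕ}
    (h : ∀ v, k ≤ (G.neighborSet v).ncard) : k ≤ G.minDegree :=
  G.le_minDegree_of_forall_le_degree k fun v => ncard_neighborSet_eq_degree G v ▸ h v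

theorem minDegree_of_iso_cycleGraph_four (e : G ≃g cycleGraph 4) : G.minDegree = 2 := by
  rw [e.minDegree_eq]
  rfl

theorem minDegree_of_iso_cycleGraph_four_sum_pathGraph_two
    (e : G ≃g cycleGraph 4 ⊕g pathGraph 2) (h : ∀ v, 1 ≤ (G.neighborSet v).ncard) :
    G.minDegree = 1 := by
  have : Nonempty V := ⟨e.symm (Sum.inr 0)⟩
  refine le_antisymm ((G.minDegree_le_degree (e.symm (Sum.inr 0))).trans ?_)
    (le_minDegree_of_forall_le_ncard h)
  have neighborSet_eq : (pathGraph 2).neighborSet 0 = {1} := by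
    ext i
    fin_cases i <;> simp [pathGraph_adj]
  rw [← ncard_neighborSet_eq_degree, ncard_neighborSet_of_iso_sum, neighborSet_eq,
    Set.ncard_singleton]

theorem sumNumber_le_minDegree (h : ∀ v, (G.neighborSet v).ncard ∈ Set.Icc 1 2)
    (hG : ¬ Nonempty (G ≃g cycleGraph 4)) (hG' : ¬ Nonempty (G ≃g cycleGraph 4 ⊕g pathGraph 2)) :
    G.sumNumber ≤ G.minDegree := by
  rcases isEmpty_or_nonempty V with hV | hV
  · rw [sumNumber_eq_zero_of_isEmpty]
    exact Nat.zero_le _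
  by_cases hx : ∃ x, (G.neighborSet x).ncard = 1
  · obtain ⟨x, hx⟩ := hx
    exact (sumNumber_le_one h hx hG').trans (le_minDegree_of_forall_le_ncard fun v => (h v).1)
  · push Not at hx
    exact (sumNumber_le_two h hG).trans
      (le_minDegree_of_forall_le_ncard fun v => Nat.succ_le_of_lt ((h v).1.lt_of_ne' (hx v)))

end MinDegree

end SumGraph

theorem theorem1 {V : Type u} [Fintype V] (G : SimpleGraph V) [DecidableRel G.Adj]
    (hmax : G.maxDegree ≤ 2) (hiso : ∀ v : V, ¬ G.IsIsolated v) :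
    ((Nonempty (G ≃g SimpleGraph.cycleGraph 4) ∨
        Nonempty (G ≃g (SimpleGraph.cycleGraph 4 ⊕g SimpleGraph.pathGraph 2))) →
      G.sumNumber = G.minDegree + 1) ∧
    (¬ (Nonempty (G ≃g SimpleGraph.cycleGraph 4) ∨
        Nonempty (G ≃g (SimpleGraph.cycleGraph 4 ⊕g SimpleGraph.pathGraph 2))) →
      G.sumNumber = G.minDegree) := by
  have hdeg := SumGraph.ncard_neighborSet_mem_Icc hmax hiso
  refine ⟨?_, fun hG => ?_⟩
  · rintro (⟨⟨e⟩⟩ | ⟨⟨e⟩⟩)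
    · rw [SumGraph.sumNumber_of_iso_cycleGraph_four e, SumGraph.minDegree_of_iso_cycleGraph_four e]
    · rw [SumGraph.sumNumber_of_iso_cycleGraph_four_sum_pathGraph_two e,
        SumGraph.minDegree_of_iso_cycleGraph_four_sum_pathGraph_two e fun v => (hdeg v).1]
  · rw [not_or] at hG
    have hsum := SumGraph.isSumGraph_addIsolates_sumNumber G
    exact le_antisymm (SumGraph.sumNumber_le_minDegree hdeg hG.1 hG.2)
      (SumGraph.minDegree_le_of_isSumGraph_addIsolates hsum)
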